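/- Let $V$ be the universe of sets and, for an ordinal $\theta$, let $V_\theta$ be the $\theta$-th level of the cumulative hierarchy, regarded as the structure $\langle V_\theta,\in\rangle$ for the first-order language of set theory. For a structure $M$ and $P\subseteq M$, an element $a\in M$ is $P$-definable in $M$ if there are a first-order formula $\varphi$ and parameters $\vec p$ from $P$ such that $a$ is the unique $b\in M$ with $M\models\varphi[b,\vec p]$; it is $P$-algebraic in $M$ if there are such $\varphi$ and $\vec p$ for which $\{b\in M : M\models\varphi[b,\vec p]\}$ is a finite set containing $a$. A set $a$ is ordinal definable if there is an ordinal $\theta$ such that $a\in V_\theta$ is $\theta$-definable in $V_\theta$ (the parameters being ordinals below $\theta$), and ordinal algebraic if there is an ordinal $\theta$ such that $a\in V_\theta$ is $\theta$-algebraic in $V_\theta$. Let $\mathrm{HOD}$ (respectively $\mathrm{HOA}$) be the class of hereditarily ordinal definable (respectively hereditarily ordinal algebraic) sets, that is, of all sets $a$ such that $a$ and every element of the transitive closure of $a$ are ordinal definable (respectively ordinal algebraic). Then $$\mathrm{HOA}=\mathrm{HOD}.$$ -/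

import Mathlib

universe u

/-- The relation symbols of the language of set theory: a single binary symbol for membership. -/
inductive SetLangRel : ℕ → Type
  | mem : SetLangRel 2

/-- The first-order language of set theory `{∈}` (equality is a logical symbol). -/
def setLang : FirstOrder.Language.{0, 0} := ⟨fun _ => Empty, SetLangRel⟩

/-- A set `M`, regarded as the structure `⟨M, ∈⟩`. -/
instance ZFSet.setLangStructure (M : ZFSet.{u}) : setLang.Structure M where
  funMap f := Empty.elim f
  RelMap {_} r :=
    match r with
    | .mem => fun x => (x 0 : ZFSet.{u}) ∈ (x 1 : ZFSet.{u})

section Elements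

universe v w u'

variable (L : FirstOrder.Language.{v, w}) {M : Type u'} [L.Structure M]

/-- `a` is `P`-definable in `M`: it is the unique object of `M` satisfying some first-order formula
with parameters from `P`. -/
def IsDefinableIn (P : Set M) (a : M) : Prop :=
  P.Definable₁ L {a}

/-- `a` is `P`-algebraic in `M`: it is one of only finitely many objects of `M` satisfying some
first-order formula with parameters from `P`. -/
def IsAlgebraicIn (P : Set M) (a : M) : Prop :=
  ∃ s : Set M, P.Definable₁ L s ∧ s.Finite ∧ a ∈ s

end Elements

namespace ZFSet

/-- The (von Neumann) ordinals below `θ`, as a set of elements of `V_θ`. -/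
def ordinalsBelow (θ : Ordinal.{u}) : Set (vonNeumann θ) :=
  {x | ∃ α < θ, (x : ZFSet.{u}) = α.toZFSet}

/-- `a` is ordinal definable: it is `θ`-definable in `⟨V_θ, ∈⟩` for some ordinal `θ`. -/
def OrdinalDefinable (a : ZFSet.{u}) : Prop :=
  ∃ (θ : Ordinal.{u}) (h : a ∈ vonNeumann θ), IsDefinableIn setLang (ordinalsBelow θ) ⟨a, h⟩

/-- `a` is ordinal algebraic: it is `θ`-algebraic in `⟨V_θ, ∈⟩` for some ordinal `θ`. -/
def OrdinalAlgebraic (a : ZFSet.{u}) : Prop :=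
  ∃ (θ : Ordinal.{u}) (h : a ∈ vonNeumann θ), IsAlgebraicIn setLang (ordinalsBelow θ) ⟨a, h⟩

/-- The class of hereditarily ordinal definable sets. -/
def HOD : Class.{u} := {a | Hereditarily OrdinalDefinable a}

/-- The class of hereditarily ordinal algebraic sets. -/
def HOA : Class.{u} := {a | Hereditarily OrdinalAlgebraic a}

end ZFSet

open FirstOrder FirstOrder.Language

/-! ### Closure of definability under connectives and quantifiers -/

namespace Set.Definable

universe v w u' x

variable {L : FirstOrder.Language.{v, w}} {M : Type u'} [L.Structure M] {A : Set M} {α : Type x}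

/-! By ∈-induction it suffices that an ordinal algebraic `a` with ordinal definable elements is
ordinal definable. Over all θ, choose a finite definable `s` containing `a` of least size. If some
`b ∈ s` missed some `d ∈ a`, then `{x ∈ s | d ∈ x}` would be a smaller such set; so `a` is the
⊆-least element of `s`. Since `s` and `d` may be definable at different levels, definability must
pass from `V_θ` to any larger `V_η` (`definable_image_inclusion`). This is relativization, once
`V_θ` is definable in `V_η` from θ (`eq_vonNeumann_iff`). -/

theorem and_pred {P Q : (α → M) → Prop} (hP : A.Definable L {v | P v})
    (hQ : A.Definable L {v | Q v}) : A.Definable L {v | P v ∧ Q v} :=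
  hP.inter hQ

theorem not_pred {P : (α → M) → Prop} (hP : A.Definable L {v | P v}) :
    A.Definable L {v | ¬ P v} :=
  hP.compl

theorem imp_pred {P Q : (α → M) → Prop} (hP : A.Definable L {v | P v})
    (hQ : A.Definable L {v | Q v}) : A.Definable L {v | P v → Q v} := by
  simpa only [not_and, not_not] using (hP.and_pred hQ.not_pred).not_pred

theorem iff_pred {P Q : (α → M) → Prop} (hP : A.Definable L {v | P v})
    (hQ : A.Definable L {v | Q v}) : A.Definable L {v | P v ↔ Q v} := by
  simpa only [iff_iff_implies_and_implies] using (hP.imp_pred hQ).and_pred (hQ.imp_pred hP)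

theorem exists_pred {P : (α → M) → M → Prop}
    (hP : A.Definable L {v : Option α → M | P (fun i => v (some i)) (v none)}) :
    A.Definable L {v | ∃ x, P v x} := by
  have h := (hP.preimage_comp
    (fun i : Option α => i.elim (Sum.inr ()) Sum.inl : Option α → α ⊕ Unit)).exists_of_finite
  convert! h using 1
  ext v
  exact ⟨fun ⟨x, hx⟩ => ⟨fun _ => x, hx⟩, fun ⟨u, hu⟩ => ⟨u (), hu⟩⟩

theorem forall_pred {P : (α → M) → M → Prop}
    (hP : A.Definable L {v : Option α → M | P (fun i => v (some i)) (v none)}) :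
    A.Definable L {v | ∀ x, P v x} := by
  simpa only [not_exists, not_not] using (exists_pred (P := fun v x => ¬ P v x) hP.not_pred).not_pred

theorem apply_mem {s : Set M} (hs : A.Definable₁ L s) (i : α) :
    A.Definable L {v : α → M | v i ∈ s} :=
  hs.preimage_comp (fun _ => i)

end Set.Definable

/-! ### Transfer of definability along embeddings with definable range -/

section Relativization

universe v w u₁ u₂ x

variable {L : FirstOrder.Language.{v, w}} {M : Type u₁} {N : Type u₂} [L.Structure M]
  [L.Structure N] {A : Set M}

/-- Relativization of a formula to a definable substructure. -/
theorem FirstOrder.Language.BoundedFormula.exists_relativization (f : N ↪[L] M)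
    (hf : A.Definable₁ L (Set.range f)) {α : Type x} {n : ℕ} (φ : L.BoundedFormula α n) :
    ∃ ψ : L[[A]].BoundedFormula α n, ∀ (v : α → N) (xs : Fin n → N),
      ψ.Realize (f ∘ v) (f ∘ xs) ↔ φ.Realize v xs := by
  have qf : ∀ {n : ℕ} (φ : L.BoundedFormula α n), φ.IsQF →
      ∃ ψ : L[[A]].BoundedFormula α n, ∀ (v : α → N) (xs : Fin n → N),
        ψ.Realize (f ∘ v) (f ∘ xs) ↔ φ.Realize v xs := fun φ hφ =>
    ⟨(L.lhomWithConstants A).onBoundedFormula φ, fun v xs => by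
      rw [LHom.realize_onBoundedFormula, hφ.realize_embedding f]⟩
  induction φ with
  | falsum => exact qf _ BoundedFormula.IsQF.falsum
  | equal t₁ t₂ => exact qf _ (BoundedFormula.IsAtomic.equal t₁ t₂).isQF
  | rel R ts => exact qf _ (BoundedFormula.IsAtomic.rel R ts).isQF
  | imp _ _ ih₁ ih₂ =>
    obtain ⟨ψ₁, h₁⟩ := ih₁
    obtain ⟨ψ₂, h₂⟩ := ih₂
    exact ⟨ψ₁.imp ψ₂, fun v xs => by simp only [BoundedFormula.realize_imp, h₁, h₂]⟩
  | @all n _ ih =>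
    obtain ⟨ψ, hψ⟩ := ih
    obtain ⟨γ, hγ⟩ := hf
    have hγ' : ∀ y : Fin 1 → M, γ.Realize y ↔ y 0 ∈ Set.range f := fun y =>
      (Set.ext_iff.1 hγ y).symm
    -- The quantifier is bounded by the formula defining the range, applied to the newly bound
    -- variable.
    refine ⟨((BoundedFormula.relabel (fun _ => Sum.inr (Fin.last n)) γ :
      L[[A]].BoundedFormula α (n + 1 + 0)).imp ψ).all, fun v xs => ?_⟩
    have guard : ∀ y : M, (BoundedFormula.relabel (fun _ => Sum.inr (Fin.last n)) γ :
        L[[A]].BoundedFormula α (n + 1 + 0)).Realize (f ∘ v) (Fin.snoc (f ∘ xs) y) ↔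
          y ∈ Set.range f := fun y => by
      rw [BoundedFormula.realize_relabel]
      have := hγ' (fun _ => y)
      rw [Formula.Realize] at this
      rw [← this]
      have e : ∀ {a b : Fin 1 → M} {c d : Fin 0 → M}, a = b →
          (BoundedFormula.Realize γ a c ↔ BoundedFormula.Realize γ b d) := by
        rintro a _ c d rfl
        rw [Subsingleton.elim c d]
      apply e
      funext i
      simp [Fin.snoc]
    simp only [BoundedFormula.realize_all, BoundedFormula.realize_imp]
    constructor
    · intro h x
      have := h (f x) ((guard _).2 ⟨x, rfl⟩)
      rw [← Fin.comp_snoc] at this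
      exact (hψ _ _).1 this
    · rintro h y hy
      obtain ⟨x, rfl⟩ := (guard _).1 hy
      rw [← Fin.comp_snoc]
      exact (hψ _ _).2 (h x)

theorem Set.Definable₁.image_embedding (f : N ↪[L] M) (hf : A.Definable₁ L (Set.range f))
    {B : Set N} (hB : ∀ b ∈ B, f b ∈ A) {s : Set N} (hs : B.Definable₁ L s) :
    A.Definable₁ L (f '' s) := by
  obtain ⟨φ, hφ⟩ := Set.definable_iff_exists_formula_sum.1 hs
  obtain ⟨ψ, hψ⟩ := BoundedFormula.exists_relativization f hf φ
  let σ : B ⊕ Fin 1 → L[[A]].Term (Fin 1) :=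
    Sum.elim (fun b => (L.con (⟨f b, hB b b.2⟩ : A)).term) Term.var
  have hφ' : ∀ x : N, x ∈ s ↔ φ.Realize (Sum.elim (↑) fun _ : Fin 1 => x) := fun x =>
    Set.ext_iff.1 hφ fun _ => x
  have hσ : A.Definable L {y : Fin 1 → M | (BoundedFormula.subst ψ σ).Realize y default} :=
    ⟨BoundedFormula.subst ψ σ, rfl⟩
  have key : ∀ x : N, (BoundedFormula.subst ψ σ).Realize (fun _ => f x) default ↔ x ∈ s := by
    intro x
    rw [hφ', Formula.Realize, ← hψ, BoundedFormula.realize_subst]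
    have e : (fun a => (σ a).realize (fun _ : Fin 1 => f x)) =
        f ∘ Sum.elim (↑) (fun _ : Fin 1 => x) := by
      funext a
      rcases a with b | i <;> simp [σ]
    rw [e, Subsingleton.elim (f ∘ default) default]
  refine (congrArg (A.Definable L) ?_).mp (hf.inter hσ)
  ext y
  have hy : y = fun _ => y 0 := funext fun i => by rw [Subsingleton.elim i 0]
  constructor
  · rintro ⟨⟨x, hx⟩, h⟩
    refine ⟨x, (key x).1 ?_, hx⟩
    rw [hx, ← hy]
    exact h
  · rintro ⟨x, hx, hxy⟩
    refine ⟨⟨x, hxy⟩, ?_⟩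
    have := (key x).2 hx
    rw [hxy, ← hy] at this
    exact this

end Relativization

/-! ### Defining one level of the hierarchy inside another -/

namespace ZFSet

theorem definable_mem {M : ZFSet.{u}} {A : Set M} {α : Type*} (i j : α) :
    A.Definable setLang {v : α → M | (v i : ZFSet.{u}) ∈ (v j : ZFSet.{u})} := by
  refine Set.Definable.mono (Set.empty_definable_iff.2 ?_) (Set.empty_subset A)
  exact ⟨Relations.formula₂ (L := setLang) SetLangRel.mem (.var i) (.var j), rfl⟩

theorem definable_subset {M : ZFSet.{u}} {A : Set M} {α : Type*} (i j : α) :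
    A.Definable setLang
      {v : α → M | ∀ z : M,
        (z : ZFSet.{u}) ∈ (v i : ZFSet.{u}) → (z : ZFSet.{u}) ∈ (v j : ZFSet.{u})} :=
  .forall_pred (.imp_pred (definable_mem _ _) (definable_mem _ _))

/-- The inclusion of a set into a larger one, as an embedding of `∈`-structures. -/
def inclusionEmbedding {N M : ZFSet.{u}} (h : N ⊆ M) : N ↪[setLang] M where
  toFun x := ⟨x, h x.2⟩
  inj' _ _ hxy := Subtype.ext (Subtype.mk.inj hxy)
  map_fun' f := Empty.elim f
  map_rel' {_} r := match r with
    | .mem => fun _ => Iff.rfl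

/-- A `y` of rank below that of `x` has rank at most that of some `z ∈ x`; any level including `z`
then includes `y`. -/
theorem eq_vonNeumann_of_mem_iff {p : ZFSet.{u} → Prop} {x : ZFSet.{u}}
    (hp : ∀ c, p c → ∃ α, c = vonNeumann α) (hx : ∀ y, y ∈ x ↔ ∃ c, p c ∧ y ⊆ c) :
    ∃ α, x = vonNeumann α := by
  refine ⟨rank x, ext fun y => ⟨fun hy => mem_vonNeumann.2 (rank_lt_of_mem hy), fun hy => ?_⟩⟩
  obtain ⟨z, hz, hyz⟩ := lt_rank_iff.1 (mem_vonNeumann.1 hy)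
  obtain ⟨c, hc, hzc⟩ := (hx z).1 hz
  obtain ⟨α, rfl⟩ := hp c hc
  exact (hx y).2 ⟨_, hc, subset_vonNeumann.2 (hyz.trans (subset_vonNeumann.1 hzc))⟩

/-- The members of a history in the sense of Level Theory are levels of the cumulative
hierarchy. -/
theorem eq_vonNeumann_of_mem_history {h : ZFSet.{u}}
    (hh : ∀ x ∈ h, ∀ y, y ∈ x ↔ ∃ c, (c ∈ x ∧ c ∈ h) ∧ y ⊆ c) (x : ZFSet.{u}) (hx : x ∈ h) :
    ∃ α, x = vonNeumann α := by
  induction x using ZFSet.inductionOn with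
  | _ x ih => exact eq_vonNeumann_of_mem_iff (fun c hc => ih c hc.1 hc.2) (hh x hx)

theorem toZFSet_mem_vonNeumann {α β : Ordinal.{u}} : α.toZFSet ∈ vonNeumann β ↔ α < β := by
  rw [mem_vonNeumann, Ordinal.rank_toZFSet]

theorem coe_subset_coe_vonNeumann {η : Ordinal.{u}} (y c : vonNeumann η) :
    (∀ z : vonNeumann η, (z : ZFSet.{u}) ∈ (y : ZFSet.{u}) → (z : ZFSet.{u}) ∈ (c : ZFSet.{u})) ↔
      (y : ZFSet.{u}) ⊆ c :=
  ⟨fun h z hz => h ⟨z, isTransitive_vonNeumann η _ y.2 hz⟩ hz, fun h _ hz => h hz⟩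

/-- A first-order description of `V_θ` inside `V_η`, in terms of the ordinal `θ`. -/
theorem eq_vonNeumann_iff {θ η : Ordinal.{u}} (hθ : θ < η) (W : vonNeumann η) :
    (W : ZFSet.{u}) = vonNeumann θ ↔
      ∃ h : vonNeumann η,
        (∀ x : vonNeumann η, (x : ZFSet.{u}) ∈ (h : ZFSet.{u}) →
          ∀ y : vonNeumann η, (y : ZFSet.{u}) ∈ (x : ZFSet.{u}) ↔
            ∃ c : vonNeumann η,
              ((c : ZFSet.{u}) ∈ (x : ZFSet.{u}) ∧ (c : ZFSet.{u}) ∈ (h : ZFSet.{u})) ∧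
                (y : ZFSet.{u}) ⊆ c) ∧
        (∀ y : vonNeumann η, (y : ZFSet.{u}) ∈ (W : ZFSet.{u}) ↔
          ∃ c : vonNeumann η, (c : ZFSet.{u}) ∈ (h : ZFSet.{u}) ∧ (y : ZFSet.{u}) ⊆ c) ∧
        θ.toZFSet ∉ (W : ZFSet.{u}) ∧
        θ.toZFSet ⊆ (W : ZFSet.{u}) := by
  have trans : ∀ {x y : ZFSet.{u}}, y ∈ vonNeumann η → x ∈ y → x ∈ vonNeumann η :=
    fun hy hx => isTransitive_vonNeumann η _ hy hx
  constructor
  · intro hW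
    have hmem : ∀ z, z ∈ range (fun β : Set.Iio θ => vonNeumann β) ↔ ∃ β < θ, vonNeumann β = z :=
      fun z => by simp
    -- The history `{V_β | β < θ}` has rank at most θ, so it is available even when `η = θ + 1`; no
    -- pairing is needed.
    have hh : range (fun β : Set.Iio θ => vonNeumann β) ∈ vonNeumann η := by
      refine mem_vonNeumann.2 (lt_of_le_of_lt (rank_le_iff.2 fun y hy => ?_) hθ)
      obtain ⟨β, hβ, rfl⟩ := (hmem y).1 hy
      simpa using hβ
    refine ⟨⟨_, hh⟩, ?_, ?_, ?_, ?_⟩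
    · intro x hx y
      obtain ⟨β, hβ, hx⟩ := (hmem _).1 hx
      simp only [← hx, mem_vonNeumann' (o := β)]
      constructor
      · rintro ⟨γ, hγ, hy⟩
        exact ⟨⟨vonNeumann γ, vonNeumann_mem_of_lt (hγ.trans (hβ.trans hθ))⟩,
          ⟨⟨γ, hγ, fun _ => id⟩, (hmem _).2 ⟨γ, hγ.trans hβ, rfl⟩⟩, hy⟩
      · rintro ⟨c, ⟨hc, -⟩, hy⟩
        obtain ⟨γ, hγ, hc⟩ := hc
        exact ⟨γ, hγ, fun _ hz => hc (hy hz)⟩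
    · intro y
      rw [hW, mem_vonNeumann']
      constructor
      · rintro ⟨γ, hγ, hy⟩
        exact ⟨⟨vonNeumann γ, vonNeumann_mem_of_lt (hγ.trans hθ)⟩, (hmem _).2 ⟨γ, hγ, rfl⟩, hy⟩
      · rintro ⟨c, hc, hy⟩
        obtain ⟨γ, hγ, hc⟩ := (hmem _).1 hc
        exact ⟨γ, hγ, hc ▸ hy⟩
    · rw [hW, toZFSet_mem_vonNeumann]
      exact lt_irrefl θ
    · rw [hW]
      exact θ.toZFSet_subset_vonNeumann
  · rintro ⟨h, hh, hW, hθW, hWθ⟩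
    have hlevel : ∀ c, c ∈ (h : ZFSet.{u}) → ∃ α, c = vonNeumann α := by
      refine eq_vonNeumann_of_mem_history fun x hx y => ⟨fun hy => ?_, ?_⟩
      · have hxη := trans h.2 hx
        obtain ⟨c, hc⟩ := (hh ⟨x, hxη⟩ hx ⟨y, trans hxη hy⟩).1 hy
        exact ⟨c, hc⟩
      · rintro ⟨c, hc, hy⟩
        have hxη := trans h.2 hx
        have hcη := trans h.2 hc.2
        exact (hh ⟨x, hxη⟩ hx ⟨y, mem_vonNeumann_of_subset hy hcη⟩).2 ⟨⟨c, hcη⟩, hc, hy⟩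
    obtain ⟨α, hα⟩ : ∃ α, (W : ZFSet.{u}) = vonNeumann α := by
      refine eq_vonNeumann_of_mem_iff hlevel fun y => ⟨fun hy => ?_, ?_⟩
      · obtain ⟨c, hc⟩ := (hW ⟨y, trans W.2 hy⟩).1 hy
        exact ⟨c, hc⟩
      · rintro ⟨c, hc, hy⟩
        have hcη := trans h.2 hc
        exact (hW ⟨y, mem_vonNeumann_of_subset hy hcη⟩).2 ⟨⟨c, hcη⟩, hc, hy⟩
    -- The two clauses on θ give `α ≤ θ` and `θ ≤ α`.
    rw [hα, toZFSet_mem_vonNeumann, not_lt] at hθW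
    rw [hα, subset_vonNeumann, Ordinal.rank_toZFSet] at hWθ
    rw [hα, le_antisymm hθW hWθ]

theorem definable_mem_vonNeumann {θ η : Ordinal.{u}} (hθ : θ < η) :
    (ordinalsBelow η).Definable₁ setLang {x | (x : ZFSet.{u}) ∈ vonNeumann θ} := by
  have hθη : θ.toZFSet ∈ vonNeumann η := toZFSet_mem_vonNeumann.2 hθ
  have hpar : (ordinalsBelow η).Definable₁ setLang {⟨θ.toZFSet, hθη⟩} :=
    Set.Definable.singleton_of_mem _ ⟨θ, hθ, rfl⟩
  have key : ∀ x : vonNeumann η, (x : ZFSet.{u}) ∈ vonNeumann θ ↔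
      ∃ t : vonNeumann η, t ∈ ({⟨θ.toZFSet, hθη⟩} : Set (vonNeumann η)) ∧
      ∃ W : vonNeumann η, (x : ZFSet.{u}) ∈ (W : ZFSet.{u}) ∧
      ∃ h : vonNeumann η,
        (∀ x : vonNeumann η, (x : ZFSet.{u}) ∈ (h : ZFSet.{u}) →
          ∀ y : vonNeumann η, (y : ZFSet.{u}) ∈ (x : ZFSet.{u}) ↔
            ∃ c : vonNeumann η,
              ((c : ZFSet.{u}) ∈ (x : ZFSet.{u}) ∧ (c : ZFSet.{u}) ∈ (h : ZFSet.{u})) ∧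
                ∀ z : vonNeumann η,
                  (z : ZFSet.{u}) ∈ (y : ZFSet.{u}) → (z : ZFSet.{u}) ∈ (c : ZFSet.{u})) ∧
        (∀ y : vonNeumann η, (y : ZFSet.{u}) ∈ (W : ZFSet.{u}) ↔
          ∃ c : vonNeumann η, (c : ZFSet.{u}) ∈ (h : ZFSet.{u}) ∧
            ∀ z : vonNeumann η,
              (z : ZFSet.{u}) ∈ (y : ZFSet.{u}) → (z : ZFSet.{u}) ∈ (c : ZFSet.{u})) ∧
        (t : ZFSet.{u}) ∉ (W : ZFSet.{u}) ∧
        ∀ z : vonNeumann η,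
          (z : ZFSet.{u}) ∈ (t : ZFSet.{u}) → (z : ZFSet.{u}) ∈ (W : ZFSet.{u}) := by
    intro x
    simp only [coe_subset_coe_vonNeumann, Set.mem_singleton_iff, exists_eq_left]
    simp only [← eq_vonNeumann_iff hθ]
    exact ⟨fun hx => ⟨⟨vonNeumann θ, vonNeumann_mem_of_lt hθ⟩, hx, rfl⟩,
      fun ⟨W, hx, hW⟩ => hW ▸ hx⟩
  simp only [Set.Definable₁, Set.mem_ofPred_eq, key]
  refine .exists_pred (.and_pred (.apply_mem hpar _) (.exists_pred (.and_pred (definable_mem _ _)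
    (.exists_pred (.and_pred ?_ (.and_pred ?_ (.and_pred (.not_pred (definable_mem _ _))
      (definable_subset _ _))))))))
  · exact .forall_pred (.imp_pred (definable_mem _ _) (.forall_pred (.iff_pred (definable_mem _ _)
      (.exists_pred (.and_pred (.and_pred (definable_mem _ _) (definable_mem _ _))
        (definable_subset _ _))))))
  · exact .forall_pred (.iff_pred (definable_mem _ _) (.exists_pred (.and_pred (definable_mem _ _)
      (definable_subset _ _))))

theorem definable_image_inclusion {θ η : Ordinal.{u}} (hθ : θ ≤ η) {s : Set (vonNeumann θ)}
    (hs : (ordinalsBelow θ).Definable₁ setLang s) :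
    (ordinalsBelow η).Definable₁ setLang
      (inclusionEmbedding (vonNeumann_subset_of_le hθ) '' s) := by
  refine Set.Definable₁.image_embedding _ ?_ ?_ hs
  · have hrange : Set.range (inclusionEmbedding (vonNeumann_subset_of_le hθ)) =
        {x : vonNeumann η | (x : ZFSet.{u}) ∈ vonNeumann θ} :=
      Set.ext fun x => ⟨fun ⟨y, hy⟩ => hy ▸ y.2, fun hx => ⟨⟨x, hx⟩, rfl⟩⟩
    rw [hrange]
    -- When `θ = η`, the level is not an element of the structure, but it is the whole domain.
    rcases hθ.eq_or_lt with rfl | h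
    · have huniv : {x : Fin 1 → vonNeumann θ | (x 0 : ZFSet.{u}) ∈ vonNeumann θ} = Set.univ :=
        Set.eq_univ_of_forall fun x => (x 0).2
      exact (congrArg ((ordinalsBelow θ).Definable setLang) huniv).mpr Set.definable_univ
    · exact definable_mem_vonNeumann h
  · rintro b ⟨α, hα, hb⟩
    exact ⟨α, hα.trans_le hθ, hb⟩

/-- If all elements of an ordinal algebraic set are ordinal definable, then so is the set. A
smallest ordinal definable finite set containing it has it as its `⊆`-least element. -/
theorem OrdinalAlgebraic.ordinalDefinable {a : ZFSet.{u}} (ha : OrdinalAlgebraic a)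
    (hmem : ∀ d ∈ a, OrdinalDefinable d) : OrdinalDefinable a := by
  -- The level is quantified inside `p`, so minimality still applies after moving to `max θ θ'`.
  let p : ℕ → Prop := fun n => ∃ (θ : Ordinal.{u}) (h : a ∈ vonNeumann θ) (s : Set (vonNeumann θ)),
    (ordinalsBelow θ).Definable₁ setLang s ∧ s.Finite ∧ ⟨a, h⟩ ∈ s ∧ s.ncard = n
  have hp : ∃ n, p n := by
    obtain ⟨θ, h, s, hs, hfin, has⟩ := ha
    exact ⟨_, θ, h, s, hs, hfin, has, rfl⟩
  classical
  obtain ⟨θ, h, s, hs, hfin, has, hcard⟩ := Nat.find_spec hp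
  have hleast : ∀ b ∈ s, a ⊆ b := by
    intro b hb d hd
    by_contra hdb
    obtain ⟨θ', hd', hdef⟩ := hmem d hd
    have ht := definable_image_inclusion (le_max_left θ θ') hs
    have hd₁ := definable_image_inclusion (le_max_right θ θ') hdef
    set f := inclusionEmbedding (vonNeumann_subset_of_le (le_max_left θ θ'))
    set g := inclusionEmbedding (vonNeumann_subset_of_le (le_max_right θ θ'))
    let t : Set (vonNeumann (max θ θ')) := {x | x ∈ f '' s ∧
      ∃ y : vonNeumann (max θ θ'), y ∈ g '' {⟨d, hd'⟩} ∧ (y : ZFSet.{u}) ∈ (x : ZFSet.{u})}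
    have htdef : (ordinalsBelow (max θ θ')).Definable₁ setLang t :=
      .and_pred (.apply_mem ht _)
        (.exists_pred (.and_pred (.apply_mem hd₁ _) (definable_mem _ _)))
    have hts : t ⊆ f '' s := fun x hx => hx.1
    have hssub : t ⊂ f '' s := by
      refine (Set.ssubset_iff_of_subset hts).2 ⟨f b, ⟨b, hb, rfl⟩, ?_⟩
      rintro ⟨-, y, ⟨_, rfl, rfl⟩, hy⟩
      exact hdb hy
    have hlt : t.ncard < Nat.find hp := by
      rw [← hcard, ← Set.ncard_image_of_injective s f.injective]
      exact Set.ncard_lt_ncard hssub (hfin.image f)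
    exact Nat.find_min hp hlt ⟨_, vonNeumann_subset_of_le (le_max_left θ θ') h, t, htdef,
      (hfin.image f).subset hts, ⟨⟨_, has, rfl⟩, _, ⟨_, rfl, rfl⟩, hd⟩, rfl⟩
  refine ⟨θ, h, ?_⟩
  have key : ({⟨a, h⟩} : Set (vonNeumann θ)) = {x | x ∈ s ∧ ∀ y : vonNeumann θ, y ∈ s →
      ∀ z : vonNeumann θ, (z : ZFSet.{u}) ∈ (x : ZFSet.{u}) → (z : ZFSet.{u}) ∈ (y : ZFSet.{u})} := by
    ext x
    simp only [coe_subset_coe_vonNeumann, Set.mem_singleton_iff, Set.mem_ofPred_eq]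
    constructor
    · rintro rfl
      exact ⟨has, hleast⟩
    · rintro ⟨hx, hxs⟩
      exact Subtype.ext (subset_antisymm (hxs _ has) (hleast x hx))
  rw [IsDefinableIn, key]
  exact .and_pred (.apply_mem hs _)
    (.forall_pred (.imp_pred (.apply_mem hs _) (definable_subset _ _)))

theorem OrdinalDefinable.ordinalAlgebraic {a : ZFSet.{u}} (ha : OrdinalDefinable a) :
    OrdinalAlgebraic a := by
  obtain ⟨θ, h, hdef⟩ := ha
  exact ⟨θ, h, _, hdef, Set.finite_singleton _, rfl⟩

theorem hereditarily_ordinalAlgebraic_iff {a : ZFSet.{u}} :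
    Hereditarily OrdinalAlgebraic a ↔ Hereditarily OrdinalDefinable a := by
  induction a using ZFSet.inductionOn with
  | _ a ih =>
    constructor
    · intro h
      have hmem : ∀ d ∈ a, Hereditarily OrdinalDefinable d := fun d hd => (ih d hd).1 (h.mem hd)
      exact hereditarily_iff.2 ⟨h.self.ordinalDefinable fun d hd => (hmem d hd).self, hmem⟩
    · intro h
      exact hereditarily_iff.2 ⟨h.self.ordinalAlgebraic, fun d hd => (ih d hd).2 (h.mem hd)⟩

end ZFSet

theorem theorem1 : ZFSet.HOA.{u} = ZFSet.HOD.{u} := by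
  exact Set.ext fun _ => ZFSet.hereditarily_ordinalAlgebraic_iff
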